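/- Let $p\ge 1$, and let $\zeta$ be a probability measure on $(\mathbb{R},\mathcal{B})$ that is nondegenerate (not a point mass) and has mean zero. For a real $p\times p$ matrix $A$, let $F^A$ denote the cumulative distribution function of $A\epsilon$, where $\epsilon=(\epsilon_1,\dots,\epsilon_p)^t$ has independent coordinates, each with distribution $\zeta$; that is, $F^A(x)=\mathbb{P}\big((A\epsilon)_1\le x_1,\dots,(A\epsilon)_p\le x_p\big)$ for $x\in\mathbb{R}^p$. Call $\zeta$ symmetric if $Y$ and $-Y$ have the same distribution whenever $Y$ has distribution $\zeta$. Let $A$ and $B$ be invertible real $p\times p$ matrices. Then the following hold: (1) If $\zeta$ is Gaussian, then $F^A=F^B$ if and only if $AA^t=BB^t$. (2) If $\zeta$ is non-Gaussian and symmetric, then $F^A=F^B$ if and only if $A=B\Lambda P$ for some permutation matrix $P$ and some diagonal matrix $\Lambda$ satisfying $\Lambda^2=I$. (3) If $\zeta$ is non-symmetric, then $F^A=F^B$ if and only if $A=BP$ for some permutation matrix $P$. -/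

import Mathlib

open MeasureTheory ProbabilityTheory

noncomputable section

/-- A probability measure on `ℝ` is nondegenerate if it is not concentrated at one point. -/
def Nondegenerate (ζ : Measure ℝ) : Prop :=
  ∀ c : ℝ, ζ ≠ Measure.dirac c

/-- `ζ` has a finite first moment, and its mean is zero. -/
def MeanZero (ζ : Measure ℝ) : Prop :=
  Integrable (fun x : ℝ => x) ζ ∧ ∫ x, x ∂ζ = 0

/-- The cumulative distribution function of a measure on `ℝᵖ`:
`x ↦ μ ((-∞, x₁] × ⋯ × (-∞, xₚ])`. -/
def mvCDF {p : ℕ} (μ : Measure (Fin p → ℝ)) (x : Fin p → ℝ) : ℝ :=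
  μ.real (Set.univ.pi fun i => Set.Iic (x i))

/-- The law of `A ε` where `ε` has i.i.d. coordinates with law `ζ`: the image of the `p`-fold
product measure of `ζ` under `x ↦ A x`. -/
def mixedLaw {p : ℕ} (A : Matrix (Fin p) (Fin p) ℝ) (ζ : Measure ℝ) : Measure (Fin p → ℝ) :=
  (Measure.pi fun _ : Fin p => ζ).map fun x => A.mulVec x

/-- The cumulative distribution function `F^A` of `A ε`. -/
def mixedCDF {p : ℕ} (A : Matrix (Fin p) (Fin p) ℝ) (ζ : Measure ℝ) : (Fin p → ℝ) → ℝ :=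
  mvCDF (mixedLaw A ζ)

/-- `P` is a permutation matrix. -/
def IsPermMatrix {p : ℕ} (P : Matrix (Fin p) (Fin p) ℝ) : Prop :=
  ∃ σ : Equiv.Perm (Fin p), P = σ.permMatrix ℝ

end

/-- Two mutually inverse matrices whose rows have `ℓ¹`-norm at most one are monomial. -/
lemma Matrix.row_support_subsingleton_of_sum_abs_le_one {n : Type*} [Fintype n] [DecidableEq n]
    {M N : Matrix n n ℝ} (hMN : M * N = 1) (hM : ∀ i, ∑ j, |M i j| ≤ 1)
    (hN : ∀ i, ∑ j, |N i j| ≤ 1) {i j k : n} (hj : N i j ≠ 0) (hk : N i k ≠ 0) : j = k := by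
  have hN1 : ∀ i j, |N i j| ≤ 1 := fun i j =>
    (Finset.single_le_sum (f := fun j => |N i j|) (fun _ _ => abs_nonneg _)
      (Finset.mem_univ j)).trans (hN i)
  have key : ∀ i, ∃ j, |N j i| = 1 := by
    intro i
    by_contra! hne
    have hlt : ∀ j, |N j i| < 1 := fun j => lt_of_le_of_ne (hN1 j i) (hne j)
    have h1 : ∑ j, M i j * N j i = 1 := by
      have := congrFun (congrFun hMN i) i
      simpa [Matrix.mul_apply] using this
    have hex : ∃ j, M i j ≠ 0 := by
      by_contra! h0
      simp [h0] at h1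
    obtain ⟨j₀, hj₀⟩ := hex
    have : ∑ j, M i j * N j i < ∑ j, |M i j| := by
      refine Finset.sum_lt_sum (fun j _ => ?_) ⟨j₀, Finset.mem_univ _, ?_⟩
      · calc M i j * N j i ≤ |M i j| * |N j i| := by rw [← abs_mul]; exact le_abs_self _
          _ ≤ |M i j| := mul_le_of_le_one_right (abs_nonneg _) (hN1 j i)
      · calc M i j₀ * N j₀ i ≤ |M i j₀| * |N j₀ i| := by rw [← abs_mul]; exact le_abs_self _
          _ < |M i j₀| := mul_lt_of_lt_one_right (abs_pos.2 hj₀) (hlt j₀)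
    linarith [hM i]
  choose f hf using key
  have hf0 : ∀ i k, k ≠ i → N (f i) k = 0 := by
    intro i k hki
    have h := hN (f i)
    have h2 : ∑ l ∈ ({i, k} : Finset n), |N (f i) l| ≤ ∑ l, |N (f i) l| :=
      Finset.sum_le_sum_of_subset_of_nonneg (Finset.subset_univ _) fun _ _ _ => abs_nonneg _
    rw [Finset.sum_pair hki.symm, hf i] at h2
    exact abs_nonpos_iff.1 (by linarith)
  have hinj : Function.Injective f := by
    intro a b hab
    by_contra hne
    have h1 := hf0 a b (Ne.symm hne)
    have h2 := hf b
    rw [← hab, h1] at h2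
    simp at h2
  obtain ⟨l, rfl⟩ := (Finite.injective_iff_surjective.1 hinj) i
  have hj' : j = l := by
    by_contra h
    exact hj (hf0 l j h)
  have hk' : k = l := by
    by_contra h
    exact hk (hf0 l k h)
  rw [hj', hk']

/-- If `φ` vanishes at distance `r` from the origin but not closer, then a matrix preserving
`u ↦ ∏ φ (u i)` is a contraction of `ℓ^∞`. -/
lemma sum_abs_row_le_one_of_prod_mulVec_eq {n : Type*} [Fintype n]
    {φ : ℝ → ℂ} {N : Matrix n n ℝ} (H : ∀ u, ∏ i, φ (N.mulVec u i) = ∏ i, φ (u i))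
    {r : ℝ} (hr0 : 0 < r) (hr : φ r = 0) (hmin : ∀ x, |x| < r → φ x ≠ 0) (i : n) :
    ∑ j, |N i j| ≤ 1 := by
  by_contra! hs
  set s := ∑ j, |N i j| with hsdef
  have hs0 : 0 < s := by linarith
  let u : n → ℝ := fun j => r / s * SignType.sign (N i j)
  have hu : N.mulVec u i = r := by
    simp only [Matrix.mulVec, dotProduct, u]
    calc ∑ j, N i j * (r / s * SignType.sign (N i j))
        = ∑ j, r / s * |N i j| := by
          refine Finset.sum_congr rfl fun j _ => ?_
          rw [← self_mul_sign (N i j)]; ring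
      _ = r := by rw [← Finset.mul_sum, ← hsdef]; field_simp
  have h0 : ∏ i, φ (u i) = 0 := by
    rw [← H u]
    exact Finset.prod_eq_zero (Finset.mem_univ i) (by rw [hu, hr])
  obtain ⟨j, -, hj⟩ := Finset.prod_eq_zero_iff.1 h0
  refine hmin (u j) ?_ hj
  have hsg : |((SignType.sign (N i j) : SignType) : ℝ)| ≤ 1 := by
    cases SignType.sign (N i j) <;> simp
  calc |u j| = r / s * |((SignType.sign (N i j) : SignType) : ℝ)| := by
        simp only [u]; rw [abs_mul, abs_of_pos (by positivity)]
    _ ≤ r / s := mul_le_of_le_one_right (by positivity) hsg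
    _ < r := div_lt_self hr0 hs

lemma exists_pos_minimal_zero {φ : ℝ → ℂ} (hc : Continuous φ) (h0 : φ 0 ≠ 0)
    (hneg : ∀ x, φ (-x) = 0 ↔ φ x = 0) {x₀ : ℝ} (hx₀ : φ x₀ = 0) :
    ∃ r, 0 < r ∧ φ r = 0 ∧ ∀ x, |x| < r → φ x ≠ 0 := by
  have habs : ∀ x, φ |x| = 0 ↔ φ x = 0 := fun x => by
    rcases abs_choice x with h | h <;> rw [h]
    exact hneg x
  set S : Set ℝ := {x | 0 ≤ x ∧ φ x = 0}
  have hS : IsClosed S :=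
    (isClosed_le continuous_const continuous_id).inter (isClosed_eq hc continuous_const)
  have hb : BddBelow S := ⟨0, fun x hx => hx.1⟩
  have hmem : sInf S ∈ S := hS.csInf_mem ⟨|x₀|, abs_nonneg _, (habs _).2 hx₀⟩ hb
  refine ⟨sInf S, lt_of_le_of_ne hmem.1 fun h => h0 (by rw [h]; exact hmem.2), hmem.2,
    fun x hx hφ => ?_⟩
  exact absurd (csInf_le hb ⟨abs_nonneg x, (habs x).2 hφ⟩) (not_le.2 hx)

/-- Differentiating `∏ φ ((N u) i) = ∏ φ (u i)` logarithmically. -/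
lemma sum_mul_logDeriv_mulVec {n : Type*} [Fintype n] [DecidableEq n]
    {φ : ℝ → ℂ} (hd : Differentiable ℝ φ) (hne : ∀ x, φ x ≠ 0) {N : Matrix n n ℝ}
    (H : ∀ u, ∏ i, φ (N.mulVec u i) = ∏ i, φ (u i)) (u : n → ℝ) (j : n) :
    ∑ i, (N i j : ℂ) * logDeriv φ (N.mulVec u i) = logDeriv φ (u j) := by
  have hlin : ∀ a b : ℝ, logDeriv (fun s : ℝ => φ (a + s * b)) 0 = b * logDeriv φ a := by
    intro a b
    have h1 : HasDerivAt (fun s : ℝ => a + s * b) b 0 := by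
      simpa using ((hasDerivAt_id (0 : ℝ)).mul_const b).const_add a
    have h2 : HasDerivAt φ (deriv φ a) (a + 0 * b) := by simpa using (hd a).hasDerivAt
    have h3 := (h2.scomp (0 : ℝ) h1).deriv
    have h4 : deriv (fun s : ℝ => φ (a + s * b)) 0 = b • deriv φ a := h3
    rw [logDeriv_apply, logDeriv_apply, h4]
    simp [mul_div_assoc]
  have hdiff : ∀ a b : ℝ, DifferentiableAt ℝ (fun s : ℝ => φ (a + s * b)) 0 := fun a b =>
    DifferentiableAt.comp (0 : ℝ) (hd _) (by fun_prop)
  have hH : (fun s : ℝ => ∏ i, φ (N.mulVec u i + s * N i j)) =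
      fun s : ℝ => ∏ i, φ (u i + s * (Pi.single j 1 : n → ℝ) i) := by
    funext s
    have := H (u + s • Pi.single j 1)
    simpa [Matrix.mulVec_add, Matrix.mulVec_smul] using this
  have hL := congrFun (congrArg logDeriv hH) 0
  rw [logDeriv_prod (f := fun i s => φ (N.mulVec u i + s * N i j)) (fun _ _ => hne _)
      (fun _ _ => hdiff _ _),
    logDeriv_prod (f := fun i s => φ (u i + s * (Pi.single j 1 : n → ℝ) i)) (fun _ _ => hne _)
      (fun _ _ => hdiff _ _)] at hL
  simp only [hlin] at hL
  rw [hL, Finset.sum_eq_single j]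
  · simp
  · intro b _ hb; simp [hb]
  · simp

/-- If a row of `N` has two nonzero entries, then the logarithmic derivative of `φ` is additive. -/
lemma logDeriv_additive_of_prod_mulVec_eq {n : Type*} [Fintype n] [DecidableEq n]
    {φ : ℝ → ℂ} (hd : Differentiable ℝ φ) (hne : ∀ x, φ x ≠ 0) (hg0 : logDeriv φ 0 = 0)
    {M N : Matrix n n ℝ} (hNM : N * M = 1)
    (H : ∀ u, ∏ i, φ (N.mulVec u i) = ∏ i, φ (u i))
    {i j k : n} (hj : N i j ≠ 0) (hk : N i k ≠ 0) (hjk : j ≠ k) (x y : ℝ) :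
    logDeriv φ (x + y) = logDeriv φ x + logDeriv φ y := by
  set g := logDeriv φ with hg
  have hinv : ∀ u, g (N.mulVec u i) = ∑ l, (M l i : ℂ) * g (u l) := by
    intro u
    have h1 : ∀ l, g (u l) = ∑ m, (N m l : ℂ) * g (N.mulVec u m) := fun l =>
      (sum_mul_logDeriv_mulVec hd hne H u l).symm
    simp_rw [h1, Finset.mul_sum]
    rw [Finset.sum_comm]
    have h2 : ∀ m, ∑ l, (M l i : ℂ) * ((N m l : ℂ) * g (N.mulVec u m))
        = (1 : Matrix n n ℝ) m i * g (N.mulVec u m) := by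
      intro m
      rw [← hNM, Matrix.mul_apply]
      push_cast
      rw [Finset.sum_mul]
      exact Finset.sum_congr rfl fun l _ => by ring
    simp_rw [h2]
    rw [Finset.sum_eq_single i]
    · simp
    · intro b _ hb; simp [hb]
    · simp
  have hsingle : ∀ l (z : ℝ), g (N i l * z) = (M l i : ℂ) * g z := by
    intro l z
    have h := hinv (Pi.single l z)
    rw [Finset.sum_eq_single l (fun b _ hb => by simp [hb, hg0]) (by simp)] at h
    simpa [Matrix.mulVec_single, mul_comm] using h
  have h := hinv (Pi.single j (x / N i j) + Pi.single k (y / N i k))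
  rw [Finset.sum_eq_add j k hjk (fun b _ hb => by simp [hb.1, hb.2, hg0]) (by simp) (by simp)] at h
  simp only [Pi.add_apply, Pi.single_eq_same, Pi.single_eq_of_ne hjk, Pi.single_eq_of_ne hjk.symm,
    add_zero, zero_add, ← hsingle, Matrix.mulVec_add, Matrix.mulVec_single] at h
  have hx : N i j * (x / N i j) = x := mul_div_cancel₀ x hj
  have hy : N i k * (y / N i k) = y := mul_div_cancel₀ y hk
  simpa only [Pi.smul_apply, MulOpposite.smul_eq_mul_unop, MulOpposite.unop_op, Matrix.col_apply,
    hx, hy] using h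

/-- A function with continuous additive logarithmic derivative is `exp` of a quadratic monomial. -/
lemma exists_eq_exp_of_logDeriv_additive {φ : ℝ → ℂ} (hd : ContDiff ℝ 1 φ) (hne : ∀ x, φ x ≠ 0)
    (h0 : φ 0 = 1) (hadd : ∀ x y, logDeriv φ (x + y) = logDeriv φ x + logDeriv φ y) :
    ∃ c : ℂ, ∀ x : ℝ, φ x = Complex.exp (c * x ^ 2 / 2) := by
  have hcont : Continuous (logDeriv φ) :=
    (hd.continuous_deriv le_rfl).div hd.continuous hne
  have hdiff : Differentiable ℝ φ := hd.differentiable one_ne_zero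
  let L : ℝ →L[ℝ] ℂ := (AddMonoidHom.mk' (logDeriv φ) hadd).toRealLinearMap hcont
  have hL : ∀ x : ℝ, logDeriv φ x = logDeriv φ 1 * x := by
    intro x
    have h : L (x • (1 : ℝ)) = x • L 1 := map_smul L x 1
    have h' : logDeriv φ (x • (1 : ℝ)) = x • logDeriv φ 1 := h
    rw [smul_eq_mul, mul_one] at h'
    rw [h', Complex.real_smul, mul_comm]
  set c := logDeriv φ 1
  refine ⟨c, fun x => ?_⟩
  have hder : ∀ x : ℝ, HasDerivAt (fun x : ℝ => φ x * Complex.exp (-(c * x ^ 2 / 2))) 0 x := by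
    intro x
    have h1 : HasDerivAt φ (c * x * φ x) x := by
      have := (hdiff x).hasDerivAt
      have h2 := hL x
      rw [logDeriv_apply, div_eq_iff (hne x)] at h2
      rwa [h2] at this
    have h2 : HasDerivAt (fun x : ℝ => (x : ℂ)) 1 x := Complex.ofRealCLM.hasDerivAt
    have h3 : HasDerivAt (fun x : ℝ => -(c * (x : ℂ) ^ 2 / 2)) (-(c * x)) x := by
      refine ((((h2.pow 2).const_mul c).div_const 2).neg).congr_deriv ?_
      push_cast
      ring
    refine (h1.mul h3.cexp).congr_deriv ?_
    ring
  have hconst := is_const_of_deriv_eq_zero (fun x => (hder x).differentiableAt)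
    (fun x => (hder x).deriv) x 0
  simp only [h0] at hconst
  rw [Complex.exp_neg] at hconst
  have hexp := Complex.exp_ne_zero (c * (x : ℂ) ^ 2 / 2)
  field_simp at hconst
  simpa using hconst

/-- A probability measure on `ℝᵖ` is determined by its cumulative distribution function. -/
lemma mvCDF_injective {p : ℕ} {μ ν : Measure (Fin p → ℝ)} [IsProbabilityMeasure μ]
    [IsProbabilityMeasure ν] (h : mvCDF μ = mvCDF ν) : μ = ν := by
  have hspan : IsCountablySpanning (Set.range (Set.Iic : ℝ → Set ℝ)) :=
    ⟨fun n : ℕ => Set.Iic (n : ℝ), fun n => ⟨n, rfl⟩, by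
      ext x
      simpa using exists_nat_ge x⟩
  refine ext_of_generate_finite _
    (generateFrom_eq_pi (C := fun _ : Fin p => Set.range (Set.Iic : ℝ → Set ℝ))
      (fun _ => (borel_eq_generateFrom_Iic ℝ).symm.trans BorelSpace.measurable_eq.symm)
      (fun _ => hspan)).symm
    (IsPiSystem.pi fun _ => isPiSystem_Iic) ?_ (by simp)
  rintro _ ⟨s, hs, rfl⟩
  have hs' : ∀ i, ∃ x, Set.Iic x = s i := fun i => hs i (Set.mem_univ i)
  choose x hx using hs'
  have hx' : s = fun i => Set.Iic (x i) := funext fun i => (hx i).symm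
  subst hx'
  exact (measureReal_eq_measureReal_iff).1 (congrFun h x)

lemma charFunDual_real_eq (ζ : Measure ℝ) (L : StrongDual ℝ ℝ) :
    charFunDual ζ L = charFun ζ (L 1) := by
  rw [charFunDual_apply, charFun_apply_real]
  congr with x
  have : L x = x * L 1 := by
    conv_lhs => rw [← mul_one x, ← smul_eq_mul, map_smul, smul_eq_mul]
  rw [this]
  push_cast
  ring_nf

instance {p : ℕ} (A : Matrix (Fin p) (Fin p) ℝ) (ζ : Measure ℝ) [IsProbabilityMeasure ζ] :
    IsProbabilityMeasure (mixedLaw A ζ) :=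
  Measure.isProbabilityMeasure_map
    (Matrix.mulVecLin A).toContinuousLinearMap.continuous.measurable.aemeasurable

lemma charFunDual_mixedLaw {p : ℕ} (A : Matrix (Fin p) (Fin p) ℝ) (ζ : Measure ℝ)
    [IsProbabilityMeasure ζ] (L : StrongDual ℝ (Fin p → ℝ)) :
    charFunDual (mixedLaw A ζ) L =
      ∏ j, charFun ζ (A.transpose.mulVec (fun i => L (Pi.single i 1)) j) := by
  have hmap : mixedLaw A ζ = (Measure.pi fun _ : Fin p => ζ).map
      (Matrix.mulVecLin A).toContinuousLinearMap := rfl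
  rw [hmap, charFunDual_map, charFunDual_pi]
  refine Finset.prod_congr rfl fun j _ => ?_
  rw [charFunDual_real_eq]
  congr 1
  have h1 : L (A.mulVec (Pi.single j 1)) = ∑ i, A i j * L (Pi.single i 1) := by
    conv_lhs => rw [← Finset.univ_sum_single (A.mulVec (Pi.single j 1)), map_sum]
    refine Finset.sum_congr rfl fun i _ => ?_
    rw [← smul_eq_mul, ← map_smul]
    simp [← Pi.single_smul]
  simpa [Matrix.mulVec, dotProduct] using h1

lemma mixedCDF_eq_iff {p : ℕ} (A B : Matrix (Fin p) (Fin p) ℝ) (ζ : Measure ℝ)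
    [IsProbabilityMeasure ζ] :
    mixedCDF A ζ = mixedCDF B ζ ↔
      ∀ t, ∏ j, charFun ζ (A.transpose.mulVec t j) = ∏ j, charFun ζ (B.transpose.mulVec t j) := by
  constructor
  · intro h t
    have hlaw : mixedLaw A ζ = mixedLaw B ζ := mvCDF_injective h
    let L : StrongDual ℝ (Fin p → ℝ) := ∑ i, t i • ContinuousLinearMap.proj i
    have hL : (fun i => L (Pi.single i 1)) = t := by
      funext i
      simp [L, Pi.single_apply]
    have := congrArg (fun μ => charFunDual μ L) hlaw
    simpa only [charFunDual_mixedLaw, hL] using this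
  · intro h
    have hlaw : mixedLaw A ζ = mixedLaw B ζ := Measure.ext_of_charFunDual <| by
      funext L
      rw [charFunDual_mixedLaw, charFunDual_mixedLaw, h]
    rw [mixedCDF, mixedCDF, hlaw]

lemma charFun_eq_of_isNegInvariant {ζ : Measure ℝ} [IsProbabilityMeasure ζ]
    (h : ζ.IsNegInvariant) (t : ℝ) : charFun ζ (-t) = charFun ζ t := by
  have h1 : charFun (ζ.map fun x => -1 * x) t = charFun ζ (-1 * t) := charFun_map_mul (-1) t
  have h2 : ζ.map (fun x => -1 * x) = ζ := by
    simp only [neg_one_mul]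
    exact h.neg_eq_self
  rw [h2] at h1
  simpa using h1.symm

lemma map_mul_eq_of_charFun {ζ : Measure ℝ} [IsProbabilityMeasure ζ] {d : ℝ}
    (h : ∀ t, charFun ζ (d * t) = charFun ζ t) : ζ.map (fun x => d * x) = ζ := by
  have : IsProbabilityMeasure (ζ.map (fun x => d * x)) :=
    Measure.isProbabilityMeasure_map (by fun_prop)
  refine Measure.ext_of_charFun (funext fun t => ?_)
  exact (charFun_map_mul d t).trans (h t)

lemma isNegInvariant_of_charFun {ζ : Measure ℝ} [IsProbabilityMeasure ζ]
    (h : ∀ t, charFun ζ (-1 * t) = charFun ζ t) : ζ.IsNegInvariant :=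
  ⟨by simpa [Measure.neg] using map_mul_eq_of_charFun h⟩

/-- A nondegenerate law with a first moment is invariant only under scalings by `±1`. -/
lemma abs_eq_one_of_charFun {ζ : Measure ℝ} [IsProbabilityMeasure ζ]
    (hζ : Nondegenerate ζ) (hint : Integrable (fun x : ℝ => x) ζ) {d : ℝ}
    (h : ∀ t, charFun ζ (d * t) = charFun ζ t) : |d| = 1 := by
  have hmap := map_mul_eq_of_charFun h
  have h1 : ∫ x, |x| ∂ζ = |d| * ∫ x, |x| ∂ζ := by
    conv_lhs => rw [← hmap]
    rw [integral_map (by fun_prop) (by fun_prop)]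
    simp_rw [abs_mul]
    rw [integral_const_mul]
  have hne : ∫ x, |x| ∂ζ ≠ 0 := by
    intro h0
    rw [integral_eq_zero_iff_of_nonneg (fun x => abs_nonneg x) hint.abs] at h0
    refine hζ 0 ?_
    have hae : (fun x : ℝ => x) =ᵐ[ζ] fun _ => 0 := by
      filter_upwards [h0] with x hx using by simpa using hx
    have hmap0 : ζ.map (fun x : ℝ => x) = ζ.map fun _ => (0 : ℝ) := Measure.map_congr hae
    rwa [Measure.map_const, Measure.map_id', measure_univ, one_smul] at hmap0
  field_simp at h1
  exact h1.symm

lemma contDiff_charFun_of_integrable {ζ : Measure ℝ} [IsProbabilityMeasure ζ]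
    (hint : Integrable (fun x : ℝ => x) ζ) : ContDiff ℝ 1 (charFun ζ) := by
  have h : MemLp id ((1 : ℕ) : ENNReal) ζ := by
    rw [Nat.cast_one]
    exact memLp_one_iff_integrable.2 hint
  exact_mod_cast contDiff_charFun h

lemma logDeriv_charFun_zero {ζ : Measure ℝ} [IsProbabilityMeasure ζ] (hζ : MeanZero ζ) :
    logDeriv (charFun ζ) 0 = 0 := by
  have h : MemLp id ((1 : ℕ) : ENNReal) ζ := by
    rw [Nat.cast_one]
    exact memLp_one_iff_integrable.2 hζ.1
  have h1 := iteratedDeriv_charFun_zero h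
  have h2 := hζ.2
  rw [iteratedDeriv_one] at h1
  rw [logDeriv_apply, h1]
  simp [h2]

/-- A law whose characteristic function is `exp (c t² / 2)` is Gaussian. -/
lemma isGaussian_of_charFun_eq_exp {ζ : Measure ℝ} [IsProbabilityMeasure ζ] {c : ℂ}
    (h : ∀ x : ℝ, charFun ζ x = Complex.exp (c * x ^ 2 / 2)) : IsGaussian ζ := by
  have hnorm : ∀ x : ℝ, c.re * x ^ 2 / 2 ≤ 0 := by
    intro x
    have h1 := norm_charFun_le_one (μ := ζ) x
    rw [h, Complex.norm_exp, Real.exp_le_one_iff] at h1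
    have : (c * (x : ℂ) ^ 2 / 2).re = c.re * x ^ 2 / 2 := by
      rw [show c * (x : ℂ) ^ 2 / 2 = ((x ^ 2 / 2 : ℝ) : ℂ) * c by push_cast; ring,
        Complex.re_ofReal_mul]
      ring
    linarith
  have hre : c.re ≤ 0 := by
    have := hnorm 1
    linarith
  have hreal : ∀ x : ℝ, charFun ζ x = Complex.exp (c.re * x ^ 2 / 2) := by
    intro x
    have hsq : ∀ y : ℝ, charFun ζ y * charFun ζ y = charFun ζ y * charFun ζ (-y) := by
      intro y
      simp [h]
    have hy := hsq (x / Real.sqrt 2)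
    rw [charFun_neg, h, ← Complex.exp_conj, ← Complex.exp_add, ← Complex.exp_add] at hy
    have hs : ((Real.sqrt 2 : ℝ) : ℂ) ^ 2 = 2 := by
      rw [← Complex.ofReal_pow, Real.sq_sqrt (by norm_num)]; simp
    have hconj : (starRingEnd ℂ) c = 2 * c.re - c := by
      rw [Complex.re_eq_add_conj]; ring
    rw [h]
    convert hy using 2
    · push_cast
      rw [div_pow, hs]; ring
    · simp only [map_div₀, map_mul, map_pow, Complex.conj_ofReal, map_ofNat, hconj]
      push_cast
      rw [div_pow, hs]; ring
  have : ζ = gaussianReal 0 (-c.re).toNNReal := by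
    refine Measure.ext_of_charFun (funext fun x => ?_)
    rw [hreal, charFun_gaussianReal]
    congr 1
    have : (((-c.re).toNNReal : ℝ) : ℂ) = -c.re := by
      rw [Real.coe_toNNReal _ (by linarith)]; simp
    rw [this]
    push_cast
    ring
  rw [this]
  infer_instance

/-- An invertible matrix with at most one nonzero entry in each row is a diagonal matrix times a
permutation matrix. -/
lemma Matrix.exists_eq_diagonal_mul_permMatrix {n : Type*} [Fintype n] [DecidableEq n]
    {M N : Matrix n n ℝ} (hNM : N * M = 1)
    (hrow : ∀ i j k, N i j ≠ 0 → N i k ≠ 0 → j = k) :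
    ∃ (d : n → ℝ) (σ : Equiv.Perm n), N = Matrix.diagonal d * σ.permMatrix ℝ := by
  have hMN : M * N = 1 := mul_eq_one_comm.1 hNM
  have hex : ∀ i, ∃ j, N i j ≠ 0 := by
    intro i
    by_contra! h
    have := congrFun (congrFun hNM i) i
    simp [Matrix.mul_apply, h] at this
  choose f hf using hex
  have hsurj : Function.Surjective f := by
    intro j
    by_contra! h
    have h0 : ∀ i, N i j = 0 := fun i => by
      by_contra hij
      exact h i (hrow i _ _ (hf i) hij)
    have := congrFun (congrFun hMN j) j
    simp [Matrix.mul_apply, h0] at this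
  refine ⟨fun i => N i (f i), Equiv.ofBijective f (Finite.surjective_iff_bijective.1 hsurj), ?_⟩
  ext i j
  rw [Matrix.diagonal_mul, Equiv.Perm.permMatrix, PEquiv.toMatrix_apply]
  by_cases h : f i = j
  · simp [h]
  · have h0 : N i j = 0 := by
      by_contra hij
      exact h (hrow i _ _ (hf i) hij)
    simp [h, h0]

lemma Matrix.diagonal_mul_permMatrix_mulVec {n : Type*} [Fintype n] [DecidableEq n]
    (d : n → ℝ) (σ : Equiv.Perm n) (u : n → ℝ) (i : n) :
    (Matrix.diagonal d * σ.permMatrix ℝ).mulVec u i = d i * u (σ i) := by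
  rw [← Matrix.mulVec_mulVec, Matrix.mulVec_diagonal, Matrix.permMatrix_mulVec, Function.comp_apply]

/-- A matrix with two nonzero entries in a row that preserves the law of an i.i.d. vector forces
the coordinates to be Gaussian. -/
lemma row_support_subsingleton_of_not_isGaussian {n : Type*} [Fintype n] [DecidableEq n]
    {ζ : Measure ℝ} [IsProbabilityMeasure ζ] (hmean : MeanZero ζ) (hng : ¬ IsGaussian ζ)
    {M N : Matrix n n ℝ} (hNM : N * M = 1)
    (H : ∀ u, ∏ i, charFun ζ (N.mulVec u i) = ∏ i, charFun ζ (u i))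
    {i j k : n} (hj : N i j ≠ 0) (hk : N i k ≠ 0) : j = k := by
  have hMN : M * N = 1 := mul_eq_one_comm.1 hNM
  have HM : ∀ u, ∏ i, charFun ζ (M.mulVec u i) = ∏ i, charFun ζ (u i) := by
    intro u
    have := H (M.mulVec u)
    rw [Matrix.mulVec_mulVec, hNM, Matrix.one_mulVec] at this
    exact this.symm
  have h0 : charFun ζ 0 = 1 := by simp
  by_cases hz : ∃ x, charFun ζ x = 0
  · obtain ⟨x₀, hx₀⟩ := hz
    obtain ⟨r, hr0, hr, hmin⟩ := exists_pos_minimal_zero (φ := charFun ζ) continuous_charFun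
      (by simp) (fun x => by rw [charFun_neg, map_eq_zero]) hx₀
    exact Matrix.row_support_subsingleton_of_sum_abs_le_one hMN
      (sum_abs_row_le_one_of_prod_mulVec_eq HM hr0 hr hmin)
      (sum_abs_row_le_one_of_prod_mulVec_eq H hr0 hr hmin) hj hk
  · by_contra hjk
    have hne : ∀ x, charFun ζ x ≠ 0 := not_exists.1 hz
    have hC := contDiff_charFun_of_integrable hmean.1
    obtain ⟨c, hc⟩ := exists_eq_exp_of_logDeriv_additive hC hne h0
      (logDeriv_additive_of_prod_mulVec_eq (hC.differentiable one_ne_zero) hne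
        (logDeriv_charFun_zero hmean) hNM H hj hk hjk)
    exact hng (isGaussian_of_charFun_eq_exp hc)

lemma exists_eq_mul_diagonal_mul_permMatrix {p : ℕ} {ζ : Measure ℝ} [IsProbabilityMeasure ζ]
    (hζ : Nondegenerate ζ) (hmean : MeanZero ζ) (hng : ¬ IsGaussian ζ)
    {A B : Matrix (Fin p) (Fin p) ℝ} (hA : IsUnit A) (hB : IsUnit B)
    (h : mixedCDF A ζ = mixedCDF B ζ) :
    ∃ (d : Fin p → ℝ) (σ : Equiv.Perm (Fin p)),
      (∀ i t, charFun ζ (d i * t) = charFun ζ t) ∧ (∀ i, d i * d i = 1) ∧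
        A = B * Matrix.diagonal d * σ.permMatrix ℝ := by
  rw [mixedCDF_eq_iff] at h
  have hAd : IsUnit A.det := (Matrix.isUnit_iff_isUnit_det A).1 hA
  have hBd : IsUnit B.det := (Matrix.isUnit_iff_isUnit_det B).1 hB
  set N := (A⁻¹ * B).transpose with hN
  have hNM : N * (B⁻¹ * A).transpose = 1 := by
    rw [hN, ← Matrix.transpose_mul, Matrix.mul_assoc, Matrix.mul_nonsing_inv_cancel_left A B hAd,
      Matrix.nonsing_inv_mul B hBd, Matrix.transpose_one]
  have H : ∀ u, ∏ i, charFun ζ (N.mulVec u i) = ∏ i, charFun ζ (u i) := by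
    intro u
    have := h ((A⁻¹).transpose.mulVec u)
    rw [Matrix.mulVec_mulVec, Matrix.mulVec_mulVec, ← Matrix.transpose_mul, ← Matrix.transpose_mul,
      Matrix.nonsing_inv_mul A hAd, Matrix.transpose_one, Matrix.one_mulVec] at this
    exact this.symm
  obtain ⟨d, σ, hdσ⟩ := Matrix.exists_eq_diagonal_mul_permMatrix hNM fun i j k hj hk =>
    row_support_subsingleton_of_not_isGaussian hmean hng hNM H hj hk
  have hinv : ∀ i t, charFun ζ (d i * t) = charFun ζ t := by
    intro i t
    have := H (Pi.single (σ i) t)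
    simp only [hdσ, Matrix.diagonal_mul_permMatrix_mulVec] at this
    rw [Finset.prod_eq_single i, Finset.prod_eq_single (σ i)] at this
    · simpa using this
    · intro b _ hb; simp [hb]
    · simp
    · intro b _ hb
      simp [Pi.single_eq_of_ne (σ.injective.ne hb)]
    · simp
  have hsq : ∀ i, d i * d i = 1 := fun i => by
    rw [← abs_mul_abs_self, abs_eq_one_of_charFun hζ hmean.1 (hinv i), mul_one]
  refine ⟨d, σ, hinv, hsq, ?_⟩
  have hNN : N * N.transpose = 1 := by
    have hP : σ.permMatrix ℝ * (σ⁻¹).permMatrix ℝ = 1 := by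
      rw [← Matrix.permMatrix_mul]; simp
    rw [hdσ, Matrix.transpose_mul, Matrix.diagonal_transpose, Matrix.transpose_permMatrix,
      Matrix.mul_assoc, ← Matrix.mul_assoc (σ.permMatrix ℝ), hP, Matrix.one_mul,
      Matrix.diagonal_mul_diagonal]
    simp [hsq]
  have hNN' : N.transpose * N = 1 := mul_eq_one_comm.1 hNN
  have hB' : A * N.transpose = B := by
    rw [hN, Matrix.transpose_transpose, Matrix.mul_nonsing_inv_cancel_left A B hAd]
  rw [Matrix.mul_assoc, ← hdσ, ← hB', Matrix.mul_assoc, hNN', Matrix.mul_one]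

lemma mixedCDF_mul_diagonal_mul_permMatrix {p : ℕ} {ζ : Measure ℝ} [IsProbabilityMeasure ζ]
    (B : Matrix (Fin p) (Fin p) ℝ) {d : Fin p → ℝ} (σ : Equiv.Perm (Fin p))
    (hd : ∀ i t, charFun ζ (d i * t) = charFun ζ t) :
    mixedCDF (B * Matrix.diagonal d * σ.permMatrix ℝ) ζ = mixedCDF B ζ := by
  rw [mixedCDF_eq_iff]
  intro t
  rw [Matrix.transpose_mul, Matrix.transpose_mul, Matrix.diagonal_transpose,
    Matrix.transpose_permMatrix, ← Matrix.mulVec_mulVec, ← Matrix.mulVec_mulVec,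
    Matrix.permMatrix_mulVec]
  simp only [Function.comp_apply]
  rw [Equiv.prod_comp σ⁻¹
    (fun j => charFun ζ ((Matrix.diagonal d).mulVec (B.transpose.mulVec t) j))]
  simp only [Matrix.mulVec_diagonal, hd]

lemma charFun_eq_of_isGaussian {ζ : Measure ℝ} (hmean : MeanZero ζ) (hG : IsGaussian ζ) :
    ∀ t : ℝ, charFun ζ t = Complex.exp ((-(Var[id; ζ].toNNReal / 2 * t ^ 2) : ℝ)) := by
  intro t
  have h := hG.eq_gaussianReal
  have hm : ∫ x, id x ∂ζ = 0 := hmean.2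
  rw [hm] at h
  conv_lhs => rw [h]
  rw [charFun_gaussianReal]
  congr 1
  push_cast
  ring

lemma Matrix.sum_sq_transpose_mulVec {n : Type*} [Fintype n] (A : Matrix n n ℝ) (t : n → ℝ) :
    ∑ j, (A.transpose.mulVec t j) ^ 2 = t ⬝ᵥ (A * A.transpose).mulVec t := by
  rw [← Matrix.mulVec_mulVec, Matrix.dotProduct_mulVec, ← Matrix.mulVec_transpose]
  simp [dotProduct, sq]

/-- A symmetric matrix is determined by its quadratic form. -/
lemma Matrix.IsSymm.ext_of_quadratic {n : Type*} [Fintype n] [DecidableEq n] {S T : Matrix n n ℝ}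
    (hS : S.IsSymm) (hT : T.IsSymm) (h : ∀ t, t ⬝ᵥ S.mulVec t = t ⬝ᵥ T.mulVec t) : S = T := by
  ext i j
  have hij := h (Pi.single i 1 + Pi.single j 1)
  have hi := h (Pi.single i 1)
  have hj := h (Pi.single j 1)
  have h1 : S j i = S i j := hS.apply i j
  have h2 : T j i = T i j := hT.apply i j
  simp [Matrix.mulVec_add, add_dotProduct, dotProduct_add] at hij hi hj
  linarith

lemma mixedCDF_eq_iff_of_isGaussian {p : ℕ} {ζ : Measure ℝ} [IsProbabilityMeasure ζ]
    (hζ : Nondegenerate ζ) (hmean : MeanZero ζ) (hG : IsGaussian ζ)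
    (A B : Matrix (Fin p) (Fin p) ℝ) :
    mixedCDF A ζ = mixedCDF B ζ ↔ A * A.transpose = B * B.transpose := by
  rw [mixedCDF_eq_iff]
  set v := Var[id; ζ].toNNReal with hv
  have hv0 : (v : ℝ) ≠ 0 := by
    intro h0
    have h := hG.eq_gaussianReal
    rw [← hv, NNReal.coe_eq_zero.1 h0, gaussianReal_zero_var] at h
    exact hζ _ h
  have hprod : ∀ (A : Matrix (Fin p) (Fin p) ℝ) t,
      ∏ j, charFun ζ (A.transpose.mulVec t j) =
        Complex.exp ((-(v / 2 * (t ⬝ᵥ (A * A.transpose).mulVec t)) : ℝ)) := by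
    intro A t
    simp only [charFun_eq_of_isGaussian hmean hG, ← hv]
    rw [← Complex.exp_sum, ← Complex.ofReal_sum, Finset.sum_neg_distrib, ← Finset.mul_sum,
      Matrix.sum_sq_transpose_mulVec]
  constructor
  · intro h
    refine Matrix.IsSymm.ext_of_quadratic (Matrix.isSymm_mul_transpose_self A)
      (Matrix.isSymm_mul_transpose_self B) fun t => ?_
    have := h t
    rw [hprod, hprod, ← Complex.ofReal_exp, ← Complex.ofReal_exp] at this
    have := Real.exp_injective (Complex.ofReal_injective this)
    have := mul_left_cancel₀ (div_ne_zero hv0 two_ne_zero) (neg_injective this)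
    exact this
  · intro h t
    rw [hprod, hprod, h]

theorem lemma3p5 {p : ℕ} (ζ : Measure ℝ) [IsProbabilityMeasure ζ]
    (hζ_nondeg : Nondegenerate ζ) (hζ_mean : MeanZero ζ)
    (A B : Matrix (Fin p) (Fin p) ℝ) (hA : IsUnit A) (hB : IsUnit B) :
    (IsGaussian ζ →
      (mixedCDF A ζ = mixedCDF B ζ ↔ A * A.transpose = B * B.transpose)) ∧
    (¬ IsGaussian ζ → ζ.IsNegInvariant →
      (mixedCDF A ζ = mixedCDF B ζ ↔
        ∃ Λ P : Matrix (Fin p) (Fin p) ℝ,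
          Λ.IsDiag ∧ Λ ^ 2 = 1 ∧ IsPermMatrix P ∧ A = B * Λ * P)) ∧
    (¬ ζ.IsNegInvariant →
      (mixedCDF A ζ = mixedCDF B ζ ↔
        ∃ P : Matrix (Fin p) (Fin p) ℝ, IsPermMatrix P ∧ A = B * P)) := by
  refine ⟨fun hG => mixedCDF_eq_iff_of_isGaussian hζ_nondeg hζ_mean hG A B,
    fun hng hsymm => ⟨fun h => ?_, ?_⟩, fun hns => ⟨fun h => ?_, ?_⟩⟩
  · obtain ⟨d, σ, -, hsq, hAB⟩ :=
      exists_eq_mul_diagonal_mul_permMatrix hζ_nondeg hζ_mean hng hA hB h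
    refine ⟨Matrix.diagonal d, σ.permMatrix ℝ, Matrix.isDiag_diagonal d, ?_, ⟨σ, rfl⟩, hAB⟩
    rw [sq, Matrix.diagonal_mul_diagonal]
    simp [hsq]
  · rintro ⟨Λ, _, hΛ, hΛ2, ⟨σ, rfl⟩, rfl⟩
    rw [← hΛ.diagonal_diag] at hΛ2 ⊢
    refine mixedCDF_mul_diagonal_mul_permMatrix B σ fun i t => ?_
    rw [sq, Matrix.diagonal_mul_diagonal] at hΛ2
    have hi := congrFun (congrFun hΛ2 i) i
    simp only [Matrix.diagonal_apply_eq, Matrix.one_apply_eq] at hi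
    rcases mul_self_eq_one_iff.1 hi with h | h
    · rw [h, one_mul]
    · rw [h, neg_one_mul, charFun_eq_of_isNegInvariant hsymm]
  · have hng : ¬ IsGaussian ζ := fun hG => hns <| isNegInvariant_of_charFun fun t => by
      rw [charFun_eq_of_isGaussian hζ_mean hG, charFun_eq_of_isGaussian hζ_mean hG]
      simp
    obtain ⟨d, σ, hinv, hsq, hAB⟩ :=
      exists_eq_mul_diagonal_mul_permMatrix hζ_nondeg hζ_mean hng hA hB h
    have hd : d = fun _ => 1 := funext fun i => by
      rcases mul_self_eq_one_iff.1 (hsq i) with h | h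
      · exact h
      · refine absurd (isNegInvariant_of_charFun fun t => ?_) hns
        rw [← h]
        exact hinv i t
    refine ⟨σ.permMatrix ℝ, ⟨σ, rfl⟩, ?_⟩
    rw [hAB, hd, Matrix.diagonal_one, Matrix.mul_one]
  · rintro ⟨_, ⟨σ, rfl⟩, rfl⟩
    have := mixedCDF_mul_diagonal_mul_permMatrix (ζ := ζ) B (d := fun _ => 1) σ (by simp)
    rwa [Matrix.diagonal_one, Matrix.mul_one] at this
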